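/- Let $m\ge 3$ be an odd integer, $n=3^m-1$, $\delta_1=\frac{3^m-1}{2}$, $\delta_2=\frac{3^{m-1}-1}{4}+3^{m-2}$, and let $\alpha$ be a primitive element of $\mathbb F_{3^m}$. For an integer $s$ let $C_s=\{s3^j \bmod n : j\ge 0\}\subseteq\{0,1,\dots,n-1\}$ be the $3$-cyclotomic coset of $s$ modulo $n$, and put $$Z=\Big(\bigcup_{|s|<\delta_2}C_s\Big)\cup C_{\delta_1},\qquad g(x)=\prod_{i\in Z}(x-\alpha^i).$$ Then $g(x)$ has its coefficients in $\mathbb F_3$. Let $\mathcal C\subseteq\mathbb F_3^n$ be the code $\langle g(x)\rangle$ of length $n$, that is, the set of all $(c_0,\dots,c_{n-1})$ such that $c_0+c_1x+\cdots+c_{n-1}x^{n-1}$ lies in the ideal of $\mathbb F_3[x]/(x^n-1)$ generated by $g(x)$. Put $\beta=\alpha^{\delta_2}$. Then the following hold. 1. $\beta$ is a primitive element of $\mathbb F_{3^m}$, so that $\beta^0,\beta^1,\dots,\beta^{n-1}$ lists each element of $\mathbb F_{3^m}^*$ exactly once, and with the coordinates indexed by $\mathbb F_{3^m}^*$ in this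 order, $$\mathcal C=\{(\mathrm{Tr}(ax+bx^{-1}))_{x\in\mathbb F_{3^m}^*} : a,b\in\mathbb F_{3^m}\},$$ where $\mathrm{Tr}$ is the trace from $\mathbb F_{3^m}$ to $\mathbb F_3$. 2. $\mathcal C$ is a cyclic code, and it is LCD: $\mathcal C\cap\mathcal C^\perp=\{0\}$, where $\mathcal C^\perp$ is the Euclidean dual of $\mathcal C$. 3. $\mathcal C$ has parameters $[3^m-1,\,2m,\,\ge 2\delta_2]$: it has length $3^m-1$ and dimension $2m$ over $\mathbb F_3$, and its minimum Hamming distance is at least $2\delta_2$. 4. $\mathcal C$ has designed distance $2\delta_2$ (with offset $-\delta_2$), in the sense that $Z=C_{b+1}\cup C_{b+2}\cup\cdots\cup C_{b+d-1}\cup C_{\delta_1}$ with $b=-\delta_2$ and $d=2\delta_2$. -/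

import Mathlib

open Polynomial

namespace TernaryLCD

/-- The `q`-cyclotomic coset `{s, sq, sq², …} mod n` of an integer `s`, as a subset of
`{0, …, n - 1}`. -/
noncomputable def cyclotomicCoset (q n : ℕ) (s : ℤ) : Finset ℕ :=
  open Classical in
  (Finset.range n).filter fun t => ∃ j : ℕ, (t : ℤ) ≡ s * (q : ℤ) ^ j [ZMOD n]

/-- The defining set `C_{b+1} ∪ ⋯ ∪ C_{b+d-1}` of the BCH code of length `n` over `𝔽_q` with
designed distance `d` and offset `b`. -/
noncomputable def bchDefiningSet (q n d : ℕ) (b : ℤ) : Finset ℕ :=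
  (Finset.Ioo b (b + d)).biUnion (cyclotomicCoset q n)

/-- The linear map `(c₀, …, c_{n-1}) ↦ c₀ + c₁x + ⋯ + c_{n-1}x^{n-1}` from `Kⁿ` to
`K[x]/(xⁿ - 1)`. -/
noncomputable def wordToQuotient (K : Type*) [Field K] (n : ℕ) :
    (Fin n → K) →ₗ[K] (K[X] ⧸ Ideal.span {(X ^ n - 1 : K[X])}) :=
  (Ideal.Quotient.mkₐ K (Ideal.span {(X ^ n - 1 : K[X])})).toLinearMap ∘ₗ
    ∑ i : Fin n, (Polynomial.monomial (R := K) (i : ℕ)) ∘ₗ LinearMap.proj i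

/-- The cyclic code `⟨g(x)⟩` of length `n`: the words whose polynomial lies in the ideal of
`K[x]/(xⁿ - 1)` generated by `g`. -/
noncomputable def cyclicCode {K : Type*} [Field K] (n : ℕ) (g : K[X]) :
    Submodule K (Fin n → K) :=
  ((Ideal.span {Ideal.Quotient.mk (Ideal.span {(X ^ n - 1 : K[X])}) g}).restrictScalars K).comap
    (wordToQuotient K n)

/-- The Euclidean dual of a linear code. -/
def euclideanDual {K : Type*} [Field K] {n : ℕ} (C : Submodule K (Fin n → K)) :
    Submodule K (Fin n → K) where
  carrier := {a | ∀ c ∈ C, ∑ i, a i * c i = 0}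
  zero_mem' := by intro c _; simp
  add_mem' := by
    intro a b ha hb c hc
    simp [add_mul, Finset.sum_add_distrib, ha c hc, hb c hc]
  smul_mem' := by
    intro r a ha c hc
    simp [mul_assoc, ← Finset.mul_sum, ha c hc]

/-- Linear code with complementary dual. -/
def IsLCD {K : Type*} [Field K] {n : ℕ} (C : Submodule K (Fin n → K)) : Prop :=
  C ⊓ euclideanDual C = ⊥

/-- `(c₀, …, c_{n-1}) ∈ C` implies `(c_{n-1}, c₀, …, c_{n-2}) ∈ C`. -/
def IsCyclic {K : Type*} [Field K] {n : ℕ} (C : Submodule K (Fin n → K)) : Prop :=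
  ∀ c ∈ C, (fun i => c ((finRotate n).symm i)) ∈ C

/-- Any two distinct codewords have Hamming distance at least `d`. -/
def MinDistGE {K : Type*} [Field K] [DecidableEq K] {n : ℕ} (C : Submodule K (Fin n → K))
    (d : ℕ) : Prop :=
  ∀ u ∈ C, ∀ v ∈ C, u ≠ v → d ≤ hammingDist u v

/-- The words `(Tr(a x + b x⁻¹))_x`, with `a, b ∈ F`, where `x` runs through a list
`x₀, …, x_{n-1}` of nonzero elements of `F`. -/
def traceWords (K : Type*) {F : Type*} [Field K] [Field F] [Algebra K F] {n : ℕ}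
    (x : Fin n → Fˣ) : Set (Fin n → K) :=
  {c | ∃ a b : F, ∀ i, c i = Algebra.trace K F (a * (x i : F) + b * ((x i)⁻¹ : Fˣ))}

/-- `δ₁ = (3^m - 1) / 2` -/
def delta1 (m : ℕ) : ℕ := (3 ^ m - 1) / 2

/-- `δ₂ = (3^(m-1) - 1) / 4 + 3^(m-2)`; for odd `m ≥ 3` the division is exact. -/
def delta2 (m : ℕ) : ℕ := (3 ^ (m - 1) - 1) / 4 + 3 ^ (m - 2)

/-- `Z = (⋃_{|s| < δ₂} C_s) ∪ C_{δ₁}`, with 3-cyclotomic cosets modulo `3^m - 1`. -/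
noncomputable def definingSet (m : ℕ) : Finset ℕ :=
  (Finset.Ioo (-(delta2 m : ℤ)) (delta2 m)).biUnion (cyclotomicCoset 3 (3 ^ m - 1)) ∪
    cyclotomicCoset 3 (3 ^ m - 1) (delta1 m)

end TernaryLCD

/-! A word lies in the code exactly when its polynomial vanishes at `α ^ i` for all `i ∈ Z`
(`mem_cyclicCode_iff`), so everything rests on `Z` being the complement of the cosets of `δ₂` and
`-δ₂` (`mem_definingSet_iff`). No element of the coset of `δ₂` is congruent to an integer of
absolute value below `δ₂` (`not_modEq_delta2`). Conversely, `δ₁` is fixed by tripling modulo `n`, so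
`u = x - δ₁` triples along with `x`. If the orbit of `x` never meets `|s| ≤ δ₂`, then `u` always
stays near `0`, and because `m` is odd this forces `u = 0` (`tripling_orbit_eq_zero`).

As `δ₂` is prime to `n`, `β` is primitive. Trace words are then the words whose finite Fourier
transform is supported on the conjugates of `β` and `β⁻¹` (`mem_range_traceWord_iff`). The transform
at `β` and `β⁻¹` is `-b` and `-a`, which gives the dimension and, by nondegeneracy of the trace
form, the LCD property. The distance is the BCH bound for the zeros with `|s| < δ₂`. -/

namespace TernaryLCD

/-! ### Cyclotomic cosets modulo `3 ^ m - 1`. -/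

section Arithmetic

/-- One step of the tripling map on balanced residues that stay close to `0`. -/
theorem abs_tripling_step {p n u u' : ℤ} (hp : 3 ≤ p) (hn : n = 9 * p - 1)
    (hu : 4 * |u| < 11 * p - 1) (hu' : 4 * |u'| < 11 * p - 1) (h : n ∣ u' - 3 * u) :
    |u'| = 3 * |u| ∨ |u'| = n - 3 * |u| := by
  obtain ⟨t, ht⟩ := h
  have h1 := neg_abs_le u
  have h2 := le_abs_self u
  have h3 := neg_abs_le u'
  have h4 := le_abs_self u'
  have ht1 : t < 2 := by
    by_contra hc
    have : n * 2 ≤ n * t := mul_le_mul_of_nonneg_left (by omega) (by omega)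
    omega
  have ht2 : -2 < t := by
    by_contra hc
    have : n * t ≤ n * (-2) := mul_le_mul_of_nonneg_left (by omega) (by omega)
    omega
  have ht3 : t = -1 ∨ t = 0 ∨ t = 1 := by omega
  rcases abs_cases u with ⟨a, a'⟩ | ⟨a, a'⟩ <;> rcases abs_cases u' with ⟨b, b'⟩ | ⟨b, b'⟩ <;>
    rcases ht3 with rfl | rfl | rfl <;> omega

/-- A periodic orbit of odd period of the tripling map that stays close to `0` is zero. -/
theorem tripling_orbit_eq_zero {p n : ℤ} {m : ℕ} (hm : Odd m) (hp : 3 ≤ p) (hp4 : p % 4 = 3)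
    (hn : n = 9 * p - 1) (u : ℕ → ℤ) (hstep : ∀ j, n ∣ u (j + 1) - 3 * u j)
    (hper : ∀ j, u (j + m) = u j) (hu : ∀ j, 4 * |u j| < 11 * p - 1) : u 0 = 0 := by
  have step := fun j => abs_tripling_step hp hn (hu j) (hu (j + 1)) (hstep j)
  have nonneg := fun j => abs_nonneg (u j)
  -- Call a term large if it is at least `n / 4` in absolute value. A large term is followed by one
  -- below `n / 4`, and that again by a large one, so large terms recur at even distances. An odd
  -- period would then make two neighbours large.
  by_cases hlarge : ∃ j, n ≤ 4 * |u j|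
  · obtain ⟨j, hj⟩ := hlarge
    have even : ∀ k, n ≤ 4 * |u (j + 2 * k)| := by
      intro k
      induction k with
      | zero => simpa using hj
      | succ k ih =>
        have h1 := step (j + 2 * k)
        have h2 := step (j + 2 * k + 1)
        have h3 := hu (j + 2 * k + 1)
        have h4 := hu (j + 2 * k)
        rw [show j + 2 * (k + 1) = j + 2 * k + 1 + 1 by ring]
        omega
    obtain ⟨r, hr⟩ := hm
    have h1 := even (r + 1)
    rw [show j + 2 * (r + 1) = j + 1 + m by omega, hper] at h1
    have h2 := step j
    have h3 := hu (j + 1)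
    omega
  · push Not at hlarge
    -- With no large terms, the alternative `n - 3 * |u|` exceeds `n / 4` and cannot occur.
    have geom : ∀ k, |u k| = 3 ^ k * |u 0| := by
      intro k
      induction k with
      | zero => simp
      | succ k ih =>
        have h1 := step k
        have h2 := hlarge k
        have h3 := hlarge (k + 1)
        rw [pow_succ, mul_right_comm, ← ih]
        omega
    have h1 := geom m
    rw [← zero_add m, hper, zero_add] at h1
    have h2 : (1 : ℤ) < 3 ^ m := one_lt_pow₀ (by norm_num) hm.pos.ne'
    have h3 : (3 ^ m - 1) * |u 0| = 0 := by linarith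
    rcases mul_eq_zero.1 h3 with h | h
    · omega
    · exact abs_eq_zero.1 h

variable {m : ℕ}

theorem three_pow_mod_eight (hm : Odd m) : (3 : ℤ) ^ m % 8 = 3 := by
  obtain ⟨r, rfl⟩ := hm
  have h : (9 : ℤ) ^ r ≡ 1 ^ r [ZMOD 8] := Int.ModEq.pow r (by decide)
  rw [one_pow] at h
  rw [pow_succ, pow_mul]
  have := h.mul_right 3
  simpa [Int.ModEq] using this

/-- The parameters of the code in terms of `p = 3 ^ (m - 2)`. -/
theorem parameters (hm : Odd m) (hm3 : 3 ≤ m) : ∃ p : ℤ, p = 3 ^ (m - 2) ∧ 3 ≤ p ∧ p % 8 = 3 ∧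
    ((3 ^ m - 1 : ℕ) : ℤ) = 9 * p - 1 ∧ 4 * (delta2 m : ℤ) = 7 * p - 1 ∧
    2 * (delta1 m : ℤ) = 9 * p - 1 := by
  obtain ⟨r, rfl⟩ : ∃ r, m = r + 2 := ⟨m - 2, by omega⟩
  have hr : Odd r := by
    rw [Nat.odd_add] at hm
    exact hm.2 (by decide)
  have h8 := three_pow_mod_eight hr
  have h3 : (3 : ℤ) ^ 1 ≤ 3 ^ r := pow_le_pow_right₀ (by norm_num) (by omega)
  refine ⟨3 ^ r, by simp, by simpa using h3, h8, ?_⟩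
  have e1 : 3 ^ (r + 2) = 9 * 3 ^ r := by ring
  have e2 : 3 ^ (r + 2 - 1) = 3 * 3 ^ r := by
    rw [show r + 2 - 1 = r + 1 by omega]; ring
  have e3 : (((3 : ℕ) ^ r : ℕ) : ℤ) = 3 ^ r := by push_cast; rfl
  unfold delta2 delta1
  rw [e1, e2, show r + 2 - 2 = r by omega]
  generalize (3 : ℕ) ^ r = a at *
  rw [← e3] at h8 h3 ⊢
  clear e3
  omega

theorem three_pow_mul_modEq_one (m j : ℕ) :
    (3 : ℤ) ^ (m * j) ≡ 1 [ZMOD ((3 ^ m - 1 : ℕ) : ℤ)] := by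
  have : (3 : ℤ) ^ m ≡ 1 [ZMOD ((3 ^ m - 1 : ℕ) : ℤ)] := by
    rw [Nat.cast_sub (Nat.one_le_pow _ _ (by norm_num))]
    push_cast
    exact (Int.modEq_iff_dvd.2 ⟨-1, by ring⟩)
  simpa [pow_mul] using this.pow j

/-- Multiplication by a power of `3` is undone by another power of `3` modulo `3 ^ m - 1`. -/
theorem modEq_mul_three_pow {m : ℕ} (hm : 1 ≤ m) {x s : ℤ} {j : ℕ}
    (h : x * 3 ^ j ≡ s [ZMOD ((3 ^ m - 1 : ℕ) : ℤ)]) :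
    x ≡ s * 3 ^ ((m - 1) * j) [ZMOD ((3 ^ m - 1 : ℕ) : ℤ)] := by
  have h1 := (three_pow_mul_modEq_one m j).mul_left x
  have h2 := h.mul_right (3 ^ ((m - 1) * j))
  rw [mul_assoc, ← pow_add, show j + (m - 1) * j = m * j by
    obtain ⟨r, rfl⟩ : ∃ r, m = r + 1 := ⟨m - 1, by omega⟩
    simp; ring] at h2
  rw [mul_one] at h1
  exact h1.symm.trans h2

/-- Every residue has a multiple by a power of `3` that is small in absolute value, except those in
the cosets of `δ₁` and `±δ₂`. -/
theorem exists_small_or_mem_coset (hm : Odd m) (hm3 : 3 ≤ m) (x : ℤ) :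
    (∃ j : ℕ, ∃ s : ℤ, |s| < delta2 m ∧ x * 3 ^ j ≡ s [ZMOD ((3 ^ m - 1 : ℕ) : ℤ)]) ∨
    x ≡ delta1 m [ZMOD ((3 ^ m - 1 : ℕ) : ℤ)] ∨
    ∃ j : ℕ, x * 3 ^ j ≡ delta2 m [ZMOD ((3 ^ m - 1 : ℕ) : ℤ)] ∨
      x * 3 ^ j ≡ -delta2 m [ZMOD ((3 ^ m - 1 : ℕ) : ℤ)] := by
  obtain ⟨p, -, hp, hp8, hn, h2, h1⟩ := parameters hm hm3
  have hcong := fun j => three_pow_mul_modEq_one m j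
  set N : ℕ := 3 ^ m - 1 with hN
  have hNpos : 0 < N := by omega
  -- Since `2 * δ₁ = n`, centring at `δ₁` commutes with tripling modulo `n`. The bound `11 * p - 1`
  -- below is `4 * (δ₁ - δ₂)`.
  set u : ℕ → ℤ := fun j => (x * 3 ^ j - delta1 m).bmod N with hu
  have hmod : ∀ j, u j ≡ x * 3 ^ j - delta1 m [ZMOD N] := fun j => Int.bmod_emod
  have hlow : ∀ j, -(delta1 m : ℤ) ≤ u j := by
    intro j
    have := Int.le_bmod (x := x * 3 ^ j - delta1 m) hNpos
    simp only [hu]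
    omega
  have hupp : ∀ j, u j ≤ delta1 m := by
    intro j
    have := Int.bmod_lt (x := x * 3 ^ j - delta1 m) hNpos
    simp only [hu]
    omega
  by_cases hall : ∀ j, 4 * |u j| < 11 * p - 1
  · right; left
    have h0 : u 0 = 0 := by
      refine tripling_orbit_eq_zero (n := N) hm hp (by omega) hn u ?_ ?_ hall
      · intro j
        obtain ⟨a, ha⟩ := (hmod j).dvd
        obtain ⟨b, hb⟩ := (hmod (j + 1)).dvd
        refine ⟨3 * a - b + 1, ?_⟩
        rw [pow_succ] at hb
        linear_combination 3 * ha - hb + h1 - hn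
      · intro j
        simp only [hu]
        have := (hcong 1).mul_left (x * 3 ^ j)
        rw [mul_assoc, ← pow_add] at this
        have := this.sub_right (delta1 m : ℤ)
        rw [mul_one, mul_one] at this
        rw [Int.bmod_def, Int.bmod_def, this.eq]
    have := hmod 0
    rw [h0] at this
    simpa using (this.add_right (delta1 m : ℤ)).symm
  · push Not at hall
    obtain ⟨j, hj⟩ := hall
    have h3 := hlow j
    have h4 := hupp j
    have e1 : x * 3 ^ j ≡ u j + delta1 m [ZMOD N] := by
      simpa using ((hmod j).add_right (delta1 m : ℤ)).symm
    have e2 : x * 3 ^ j ≡ u j - delta1 m [ZMOD N] := by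
      refine e1.trans (Int.modEq_iff_dvd.2 ⟨-1, ?_⟩)
      linear_combination hn - h1
    -- Equality means `|u j| = δ₁ - δ₂`, which is the case of `±δ₂`; strict inequality gives a
    -- residue smaller than `δ₂`.
    rcases hj.eq_or_lt with hj | hj
    · right; right
      refine ⟨j, ?_⟩
      rcases abs_cases (u j) with ⟨a, a'⟩ | ⟨a, a'⟩
      · right
        rwa [show -(delta2 m : ℤ) = u j - delta1 m by omega]
      · left
        rwa [show (delta2 m : ℤ) = u j + delta1 m by omega]
    · left
      refine ⟨j, ?_⟩
      rcases abs_cases (u j) with ⟨a, a'⟩ | ⟨a, a'⟩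
      · exact ⟨_, abs_lt.2 ⟨by omega, by omega⟩, e2⟩
      · exact ⟨_, abs_lt.2 ⟨by omega, by omega⟩, e1⟩

/-- `δ₂` is smallest in absolute value in its coset. -/
theorem not_modEq_delta2 (hm : Odd m) (hm3 : 3 ≤ m) {s : ℤ} (hs : |s| < delta2 m) (i : ℕ) :
    ¬ s ≡ delta2 m * 3 ^ i [ZMOD ((3 ^ m - 1 : ℕ) : ℤ)] := by
  intro h
  obtain ⟨p, hpe, hp, hp8, hn, h2, h1⟩ := parameters hm hm3
  obtain ⟨hs1, hs2⟩ := abs_lt.1 hs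
  -- The exponent is normalised to `1, …, m`, not `0, …, m - 1`: exponent `0`, read as `m`, then
  -- falls under the general estimate.
  obtain ⟨k, hkm, hk⟩ : ∃ k < m, s ≡ delta2 m * 3 ^ (k + 1) [ZMOD ((3 ^ m - 1 : ℕ) : ℤ)] := by
    refine ⟨(i + (m - 1)) % m, Nat.mod_lt _ (by omega), ?_⟩
    have e := (three_pow_mul_modEq_one m ((i + (m - 1)) / m)).mul_left
      (delta2 m * 3 ^ ((i + (m - 1)) % m + 1))
    have e' := (three_pow_mul_modEq_one m 1).mul_left (delta2 m * 3 ^ i)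
    rw [mul_assoc, ← pow_add, mul_one] at e e'
    rw [show (i + (m - 1)) % m + 1 + m * ((i + (m - 1)) / m) = i + m by
      have := Nat.mod_add_div (i + (m - 1)) m
      omega] at e
    rw [mul_one] at e'
    exact h.trans (e'.symm.trans e)
  rw [hn] at hk
  obtain ⟨t, ht⟩ := hk.dvd
  rcases k with _ | k
  · rw [zero_add, pow_one] at ht
    have : t < 1 := by
      by_contra hc
      have := mul_nonneg (show (0 : ℤ) ≤ 9 * p - 1 by omega) (show 0 ≤ t - 1 by omega)
      linarith
    have : 0 < t := by
      by_contra hc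
      have := mul_nonneg (show (0 : ℤ) ≤ 9 * p - 1 by omega) (show 0 ≤ -t by omega)
      linarith
    omega
  · have hle : (3 : ℤ) ^ k ≤ p := by
      rw [hpe]
      exact pow_le_pow_right₀ (by norm_num) (by omega)
    have hpos : (0 : ℤ) < 3 ^ k := by positivity
    have hodd : Odd ((3 : ℤ) ^ k) := Odd.pow (by decide)
    -- Here `36 * δ₂ = 7 * n - 2`. The factor of `n` is odd, hence nonzero, so `4 * |s| ≥ n - 2 * p
    -- = 4 * δ₂`.
    have key : 4 * s = (9 * p - 1) * (7 * 3 ^ k - 4 * t) - 2 * 3 ^ k := by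
      rw [pow_add, pow_add] at ht
      linear_combination -4 * ht + 9 * 3 ^ k * h2
    have hne : 7 * (3 : ℤ) ^ k - 4 * t ≠ 0 := by
      obtain ⟨r, hr⟩ := hodd
      omega
    generalize 7 * (3 : ℤ) ^ k - 4 * t = e at key hne
    rcases lt_or_gt_of_ne hne with he | he <;> nlinarith

theorem mem_cyclotomicCoset {q n t : ℕ} {s : ℤ} :
    t ∈ cyclotomicCoset q n s ↔ t < n ∧ ∃ j : ℕ, (t : ℤ) ≡ s * (q : ℤ) ^ j [ZMOD n] := by
  simp [cyclotomicCoset]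

/-- The complement of the defining set consists of the cosets of `δ₂` and `-δ₂`. -/
theorem mem_definingSet_iff (hm : Odd m) (hm3 : 3 ≤ m) {t : ℕ} (ht : t < 3 ^ m - 1) :
    t ∈ definingSet m ↔ ∀ j : ℕ, ¬ (t : ℤ) ≡ delta2 m * 3 ^ j [ZMOD ((3 ^ m - 1 : ℕ) : ℤ)] ∧
      ¬ (t : ℤ) ≡ -delta2 m * 3 ^ j [ZMOD ((3 ^ m - 1 : ℕ) : ℤ)] := by
  obtain ⟨p, -, hp, hp8, hn, h2, h1⟩ := parameters hm hm3
  have hm1 : 1 ≤ m := by omega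
  simp only [definingSet, Finset.mem_union, Finset.mem_biUnion, mem_cyclotomicCoset, ht, true_and,
    Finset.mem_Ioo, Nat.cast_ofNat]
  constructor
  · have aux : ∀ (s x : ℤ) (j i : ℕ), x ≡ s * 3 ^ j [ZMOD ((3 ^ m - 1 : ℕ) : ℤ)] →
        x ≡ delta2 m * 3 ^ i [ZMOD ((3 ^ m - 1 : ℕ) : ℤ)] →
        s ≡ delta2 m * 3 ^ (i + (m - 1) * j) [ZMOD ((3 ^ m - 1 : ℕ) : ℤ)] := by
      intro s x j i h h'
      have := modEq_mul_three_pow hm1 (h.symm.trans h')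
      rwa [mul_assoc, ← pow_add] at this
    have neg : ∀ x y : ℤ, x ≡ -delta2 m * y [ZMOD ((3 ^ m - 1 : ℕ) : ℤ)] →
        -x ≡ delta2 m * y [ZMOD ((3 ^ m - 1 : ℕ) : ℤ)] := by
      intro x y h
      simpa using h.neg
    rintro (⟨s, hs, j, hj⟩ | ⟨j, hj⟩) i
    · refine ⟨fun h => not_modEq_delta2 hm hm3 (abs_lt.2 hs) _ (aux _ _ _ _ hj h), fun h => ?_⟩
      refine not_modEq_delta2 hm hm3 (s := -s) (abs_lt.2 ⟨by omega, by omega⟩) _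
        (aux _ (-t) j i ?_ (neg _ _ h))
      simpa using hj.neg
    -- If `±δ₁` shared a coset with `δ₂`, doubling would give `2 * δ₂ ≡ 0`, although `0 < 2 * δ₂ <
    -- n`.
    · have zero : ∀ s x : ℤ, 2 * s = 9 * p - 1 ∨ 2 * s = -(9 * p - 1) →
          x ≡ s * 3 ^ j [ZMOD ((3 ^ m - 1 : ℕ) : ℤ)] →
          ¬ x ≡ delta2 m * 3 ^ i [ZMOD ((3 ^ m - 1 : ℕ) : ℤ)] := by
        intro s x hs h h'
        have e := aux _ _ _ _ h h'
        have e0 : 2 * s ≡ 0 [ZMOD ((3 ^ m - 1 : ℕ) : ℤ)] := by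
          rw [hn]
          rcases hs with hs | hs
          · exact Int.modEq_zero_iff_dvd.2 ⟨1, by linarith⟩
          · exact Int.modEq_zero_iff_dvd.2 ⟨-1, by linarith⟩
        have e1 := (e.symm.mul_left 2).trans e0
        rw [← mul_assoc] at e1
        have e2 := modEq_mul_three_pow hm1 e1
        rw [zero_mul, hn] at e2
        have := Int.le_of_dvd (by omega) (Int.modEq_zero_iff_dvd.1 e2)
        omega
      refine ⟨zero _ _ (Or.inl h1) hj, fun h => zero (-delta1 m) (-t) (Or.inr (by linarith)) ?_
        (neg _ _ h)⟩
      simpa using hj.neg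
  · intro h
    rcases exists_small_or_mem_coset hm hm3 t with ⟨j, s, hs, hj⟩ | hj | ⟨j, hj | hj⟩
    · exact Or.inl ⟨s, abs_lt.1 hs, _, modEq_mul_three_pow hm1 hj⟩
    · exact Or.inr ⟨0, by simpa using hj⟩
    · exact absurd (modEq_mul_three_pow hm1 hj) (h _).1
    · exact absurd (modEq_mul_three_pow hm1 hj) (h _).2

theorem coprime_delta2 (hm : Odd m) (hm3 : 3 ≤ m) : (3 ^ m - 1).Coprime (delta2 m) := by
  obtain ⟨p, -, hp, hp8, hn, h2, h1⟩ := parameters hm hm3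
  -- The combination `7 * n - 36 * δ₂ = 2` bounds the gcd; `p % 8 = 3` makes `δ₂` odd and excludes
  -- `2`.
  have hd2 : (3 ^ m - 1).gcd (delta2 m) ∣ 2 := by
    have h : 2 = 7 * (3 ^ m - 1) - 36 * delta2 m := by omega
    rw [h]
    exact Nat.dvd_sub ((Nat.gcd_dvd_left _ _).mul_left _) ((Nat.gcd_dvd_right _ _).mul_left _)
  rcases (Nat.dvd_prime Nat.prime_two).1 hd2 with h | h
  · exact h
  · have := Nat.gcd_dvd_right (3 ^ m - 1) (delta2 m)
    rw [h] at this
    omega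

/-- The defining set is closed under multiplication by `3`. -/
theorem exists_mem_definingSet_modEq (hm3 : 3 ≤ m) {t : ℕ} (ht : t ∈ definingSet m) :
    ∃ t' ∈ definingSet m, t' ≡ t * 3 [MOD 3 ^ m - 1] := by
  have hpos : 0 < 3 ^ m - 1 := Nat.sub_pos_of_lt (Nat.one_lt_pow (by omega) (by norm_num))
  have key : ∀ s : ℤ, t ∈ cyclotomicCoset 3 (3 ^ m - 1) s →
      t * 3 % (3 ^ m - 1) ∈ cyclotomicCoset 3 (3 ^ m - 1) s := by
    intro s hs
    rw [mem_cyclotomicCoset] at hs ⊢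
    obtain ⟨-, j, hj⟩ := hs
    refine ⟨Nat.mod_lt _ hpos, j + 1, ?_⟩
    rw [Int.natCast_mod, pow_succ, ← mul_assoc, Nat.cast_mul]
    exact (Int.mod_modEq _ _).trans (hj.mul_right _)
  refine ⟨_, ?_, Nat.mod_modEq _ _⟩
  rw [definingSet, Finset.mem_union, Finset.mem_biUnion] at ht ⊢
  rcases ht with ⟨s, hs, h⟩ | h
  · exact Or.inl ⟨s, hs, key s h⟩
  · exact Or.inr (key _ h)

theorem three_pow_modEq_one_iff {l : ℕ} (hl : l < m) :
    (3 : ℤ) ^ l ≡ 1 [ZMOD ((3 ^ m - 1 : ℕ) : ℤ)] ↔ l = 0 := by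
  refine ⟨fun h => ?_, fun h => by simp [h]⟩
  by_contra hl0
  have h1 : (3 : ℕ) ^ (l + 1) ≤ 3 ^ m := Nat.pow_le_pow_right (by norm_num) hl
  have h2 : (3 : ℕ) ^ 1 ≤ 3 ^ l := Nat.pow_le_pow_right (by norm_num) (by omega)
  rw [pow_succ] at h1
  have h3 := Int.le_of_dvd (by zify at h2; linarith) h.symm.dvd
  zify at h1 h2
  rw [Nat.cast_sub (Nat.one_le_pow _ _ (by norm_num))] at h3
  push_cast at h3
  linarith

theorem not_three_pow_modEq_neg_one {l : ℕ} (hm : 2 ≤ m) (hl : l < m) :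
    ¬ (3 : ℤ) ^ l ≡ -1 [ZMOD ((3 ^ m - 1 : ℕ) : ℤ)] := by
  intro h
  have h1 : (3 : ℕ) ^ (l + 1) ≤ 3 ^ m := Nat.pow_le_pow_right (by norm_num) hl
  have h2 : (3 : ℕ) ^ 2 ≤ 3 ^ m := Nat.pow_le_pow_right (by norm_num) hm
  have h3 := Int.le_of_dvd (by have : (0 : ℤ) < 3 ^ l := by positivity
                               linarith) h.symm.dvd
  rw [pow_succ] at h1
  zify at h1 h2
  rw [Nat.cast_sub (Nat.one_le_pow _ _ (by norm_num))] at h3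
  push_cast at h3
  linarith

end Arithmetic
-- Words as polynomials: zeros, the BCH bound, trace words.
section Evaluation

variable {K F : Type*} [Field K] [Field F] [Algebra K F] {n : ℕ}

/-- The value at `y` of the polynomial `c₀ + c₁x + ⋯ + c_{n-1}x^{n-1}`. -/
noncomputable def evalWord (y : F) : (Fin n → K) →ₗ[K] F where
  toFun c := ∑ k, algebraMap K F (c k) * y ^ (k : ℕ)
  map_add' c d := by simp [add_mul, Finset.sum_add_distrib]
  map_smul' r c := by simp [Algebra.smul_def, mul_assoc, Finset.mul_sum]

theorem evalWord_apply (y : F) (c : Fin n → K) :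
    evalWord y c = ∑ k, algebraMap K F (c k) * y ^ (k : ℕ) := rfl

theorem aeval_sum_monomial (y : F) (c : Fin n → K) :
    aeval y (∑ k : Fin n, monomial (k : ℕ) (c k)) = evalWord y c := by
  simp [evalWord_apply, aeval_monomial]

theorem wordToQuotient_apply (c : Fin n → K) :
    wordToQuotient K n c =
      Ideal.Quotient.mk (Ideal.span {(X ^ n - 1 : K[X])}) (∑ k : Fin n, monomial (k : ℕ) (c k)) := by
  simp [wordToQuotient]

/-- A cyclic code is given by the zeros of its generator polynomial. -/
theorem mem_cyclicCode_iff {g : K[X]} {Z : Finset ℕ} {α : F}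
    (hg : g.map (algebraMap K F) = ∏ i ∈ Z, (X - C (α ^ i))) (hα : α ^ n = 1)
    (hinj : Set.InjOn (fun i : ℕ => α ^ i) Z) (c : Fin n → K) :
    c ∈ cyclicCode n g ↔ ∀ i ∈ Z, evalWord (α ^ i) c = 0 := by
  have hmem : c ∈ cyclicCode n g ↔
      wordToQuotient K n c ∈ Ideal.span {Ideal.Quotient.mk (Ideal.span {(X ^ n - 1 : K[X])}) g} :=
    Iff.rfl
  rw [hmem, wordToQuotient_apply, Ideal.mem_span_singleton]
  simp_rw [← aeval_sum_monomial]
  generalize (∑ k : Fin n, monomial (k : ℕ) (c k)) = p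
  constructor
  · rintro ⟨r, hr⟩ i hi
    obtain ⟨r, rfl⟩ := Ideal.Quotient.mk_surjective r
    rw [← map_mul, Ideal.Quotient.eq, Ideal.mem_span_singleton] at hr
    obtain ⟨s, hs⟩ := hr
    have hgi : aeval (α ^ i) g = 0 := by
      rw [aeval_def, ← eval_map, hg, eval_prod]
      exact Finset.prod_eq_zero hi (by simp)
    have := congrArg (aeval (α ^ i)) hs
    have hone : (α ^ i) ^ n = 1 := by rw [pow_right_comm, hα, one_pow]
    simpa [hgi, hone] using this
  · intro h
    -- Divisibility by `g` can be tested over `F`, where `g` splits into distinct linear factors.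
    refine map_dvd _ ((map_dvd_map' (algebraMap K F)).1 ?_)
    rw [hg]
    refine Finset.prod_dvd_of_coprime ?_ ?_
    · intro i hi j hj hij
      exact pairwise_coprime_X_sub_C (s := fun x : F => x) Function.injective_id
        (fun h => hij (hinj hi hj h))
    · intro i hi
      rw [dvd_iff_isRoot, IsRoot, eval_map, ← aeval_def]
      exact h i hi

/-- The BCH bound: a word with `d - 1` consecutive zeros and fewer than `d` nonzero coordinates
vanishes. -/
theorem eq_zero_of_consecutive_zeros [DecidableEq K] {α : Fˣ} (hα : orderOf α = n) {b : ℤ} {d : ℕ}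
    {c : Fin n → K} (hzero : ∀ i < d, evalWord ((α ^ (b + i) : Fˣ) : F) c = 0)
    (hcard : (Finset.univ.filter fun k => c k ≠ 0).card ≤ d) : c = 0 := by
  funext k₀
  by_contra hk
  rw [Pi.zero_apply] at hk
  set T := Finset.univ.filter fun k => c k ≠ 0 with hT
  -- `P` kills every support position except `k₀`. Weighting the vanishing values by the
  -- coefficients of `P` isolates the term of `k₀`, replacing the usual Vandermonde determinant.
  set P : F[X] := ∏ k ∈ T.erase k₀, (X - C ((α : F) ^ (k : ℕ))) with hP
  have hdeg : P.natDegree < d := by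
    rw [hP, natDegree_prod_of_monic _ _ fun k _ => monic_X_sub_C _]
    simp only [natDegree_X_sub_C, Finset.sum_const, smul_eq_mul, mul_one]
    exact (Finset.card_erase_lt_of_mem (by simp [hT, hk])).trans_le hcard
  have hsum : ∑ k, algebraMap K F (c k) * ((α ^ b : Fˣ) : F) ^ (k : ℕ) *
      P.eval ((α : F) ^ (k : ℕ)) = 0 := by
    simp_rw [eval_eq_sum_range' hdeg, Finset.mul_sum]
    rw [Finset.sum_comm]
    refine Finset.sum_eq_zero fun i hi => ?_
    have h := hzero i (Finset.mem_range.1 hi)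
    rw [evalWord_apply] at h
    rw [← mul_zero (P.coeff i), ← h, Finset.mul_sum]
    refine Finset.sum_congr rfl fun k _ => ?_
    rw [zpow_add, zpow_natCast, Units.val_mul, Units.val_pow_eq_pow_val, mul_pow, pow_right_comm]
    ring
  rw [Finset.sum_eq_single k₀ _ (by simp)] at hsum
  · rcases mul_eq_zero.1 hsum with h | h
    · rcases mul_eq_zero.1 h with h | h
      · exact hk ((map_eq_zero _).1 h)
      · exact (pow_ne_zero _ (Units.ne_zero _)) h
    · rw [hP, eval_prod, Finset.prod_eq_zero_iff] at h
      obtain ⟨k, hk', h⟩ := h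
      rw [eval_sub, eval_X, eval_C, sub_eq_zero] at h
      have h' : α ^ (k₀ : ℕ) = α ^ (k : ℕ) := Units.ext (by simpa using h)
      have := pow_injOn_Iio_orderOf (by simp [hα]) (by simp [hα]) h'
      exact (Finset.mem_erase.1 hk').1 (Fin.ext this.symm)
  · intro k _ hkk
    by_cases hck : c k = 0
    · simp [hck]
    · rw [hP, eval_prod, Finset.prod_eq_zero (i := k) (by simp [hT, hck, hkk]) (by simp), mul_zero]

/-- Injectivity of the finite Fourier transform: the extreme case of the BCH bound, with `n`
consecutive zeros and weight at most `n`. -/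
theorem eq_zero_of_evalWord_eq_zero {α : Fˣ} (hα : orderOf α = n) {c : Fin n → K}
    (h : ∀ y : Fˣ, evalWord (y : F) c = 0) : c = 0 := by
  classical
  exact eq_zero_of_consecutive_zeros hα (b := 0) (d := n) (fun i _ => h _)
    ((Finset.card_le_univ _).trans (by simp))

theorem sum_pow_eq [DecidableEq F] {y : F} (hy : y ^ n = 1) :
    ∑ k : Fin n, y ^ (k : ℕ) = if y = 1 then (n : F) else 0 := by
  rw [Fin.sum_univ_eq_sum_range (fun k => y ^ k)]
  split_ifs with h
  · simp [h]
  · rw [geom_sum_eq h, hy, sub_self, zero_div]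

/-- The trace word of `a` and `b` along the powers of `β`. -/
noncomputable def traceWord (K : Type*) {F : Type*} [Field K] [Field F] [Algebra K F] (n : ℕ)
    (β : Fˣ) : (F × F) →ₗ[K] (Fin n → K) :=
  LinearMap.pi fun k => Algebra.trace K F ∘ₗ
    (((LinearMap.mulRight K ((β ^ (k : ℕ) : Fˣ) : F)).coprod
      (LinearMap.mulRight K (((β ^ (k : ℕ))⁻¹ : Fˣ) : F))))

theorem traceWord_apply (β : Fˣ) (a b : F) (k : Fin n) :
    traceWord K n β (a, b) k =
      Algebra.trace K F (a * (β ^ (k : ℕ) : Fˣ) + b * ((β ^ (k : ℕ))⁻¹ : Fˣ)) := rfl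

theorem range_traceWord (β : Fˣ) :
    (LinearMap.range (traceWord K n β) : Set (Fin n → K)) =
      traceWords K (fun i : Fin n => β ^ (i : ℕ)) := by
  ext c
  simp only [SetLike.mem_coe, LinearMap.mem_range, Prod.exists, traceWords, Set.mem_ofPred_eq]
  refine exists_congr fun a => exists_congr fun b => ⟨?_, fun h => funext fun k => (h k).symm⟩
  rintro rfl k
  rfl

theorem isCyclic_range_traceWord {β : Fˣ} (hβ : β ^ n = 1) :
    IsCyclic (LinearMap.range (traceWord K n β)) := by
  rintro _ ⟨⟨a, b⟩, rfl⟩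
  -- The shift replaces `x` by `x * β⁻¹`; the wrap-around is `β ^ n = 1`.
  refine ⟨(a * (β⁻¹ : Fˣ), b * β), funext fun i => ?_⟩
  obtain ⟨j, rfl⟩ := (finRotate n).surjective i
  rw [Equiv.symm_apply_apply, traceWord_apply, traceWord_apply]
  have h : β ^ (finRotate n j : ℕ) = β ^ (j : ℕ) * β := by
    obtain ⟨N, rfl⟩ : ∃ N, n = N + 1 := ⟨n - 1, by have := j.2; omega⟩
    by_cases hj : j = Fin.last N
    · subst hj
      rw [finRotate_last, Fin.val_last, ← pow_succ, hβ, Fin.val_zero, pow_zero]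
    · rw [coe_finRotate_of_ne_last hj, pow_succ]
  rw [h]
  congr 1
  simp only [mul_inv, Units.val_mul, Units.val_inv_eq_inv_val]
  have := β.ne_zero
  field_simp

end Evaluation

/-! ### Frobenius and transforms over the prime field. -/

section FiniteField

variable {F : Type*} [Field F] [Algebra (ZMod 3) F] {n : ℕ}

/-- Frobenius fixes the coefficients, so one representative controls the values on a whole coset. -/
theorem evalWord_pow_three (y : F) (c : Fin n → ZMod 3) :
    evalWord (y ^ 3) c = evalWord y c ^ 3 := by
  have : CharP F 3 := charP_of_injective_algebraMap (algebraMap (ZMod 3) F).injective 3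
  simp only [evalWord_apply]
  rw [sum_pow_char]
  refine Finset.sum_congr rfl fun k _ => ?_
  rw [mul_pow, ← map_pow, ZMod.pow_card, pow_right_comm]

theorem evalWord_pow_three_pow (y : F) (c : Fin n → ZMod 3) (j : ℕ) :
    evalWord (y ^ 3 ^ j) c = evalWord y c ^ 3 ^ j := by
  induction j with
  | zero => simp
  | succ j ih => rw [pow_succ, pow_mul, evalWord_pow_three, ih, ← pow_mul]

/-- The values of a trace word at the `n`-th roots of unity. -/
theorem evalWord_traceWord [Finite F] [DecidableEq F] {β : Fˣ} (hβ : β ^ n = 1) (a b : F)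
    {y : Fˣ} (hy : y ^ n = 1) :
    evalWord (y : F) (traceWord (ZMod 3) n β (a, b)) =
      ∑ l ∈ Finset.range (Module.finrank (ZMod 3) F),
        ((if β ^ 3 ^ l * y = 1 then a ^ 3 ^ l * n else 0) +
          if (β ^ 3 ^ l)⁻¹ * y = 1 then b ^ 3 ^ l * n else 0) := by
  have : CharP F 3 := charP_of_injective_algebraMap (algebraMap (ZMod 3) F).injective 3
  simp only [evalWord_apply, traceWord_apply, FiniteField.algebraMap_trace_eq_sum_pow,
    Nat.card_zmod, Finset.sum_mul]
  rw [Finset.sum_comm]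
  refine Finset.sum_congr rfl fun l _ => ?_
  have h : ∀ (x : Fˣ) (z : F), x ^ n = 1 →
      ∑ k : Fin n, z ^ 3 ^ l * ((x ^ 3 ^ l * y : Fˣ) : F) ^ (k : ℕ) =
        if x ^ 3 ^ l * y = 1 then z ^ 3 ^ l * n else 0 := by
    intro x z hx
    rw [← Finset.mul_sum, sum_pow_eq]
    · simp only [Units.val_eq_one, mul_ite, mul_zero]
    · rw [← Units.val_pow_eq_pow_val, mul_pow, hy, pow_right_comm, hx]
      simp
  rw [← inv_pow, ← h β a hβ, ← h β⁻¹ b (by simp [hβ]), ← Finset.sum_add_distrib]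
  refine Finset.sum_congr rfl fun k _ => ?_
  rw [add_pow_char_pow]
  push_cast
  ring

/-- A set of elements of `F` stable under the Frobenius is the set of zeros of a polynomial over
the prime field. -/
theorem exists_map_eq_prod (S : Finset F) (hS : ∀ y ∈ S, y ^ 3 ∈ S) :
    ∃ g : (ZMod 3)[X], g.map (algebraMap (ZMod 3) F) = ∏ y ∈ S, (X - C y) := by
  classical
  have : CharP F 3 := charP_of_injective_algebraMap (algebraMap (ZMod 3) F).injective 3
  have himage : S.image (frobenius F 3) = S :=
    Finset.eq_of_subset_of_card_le (Finset.image_subset_iff.2 fun y hy => hS y hy)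
      (Finset.card_image_of_injective _ (frobenius_inj F 3)).ge
  -- Frobenius permutes the linear factors, so it fixes each coefficient `z`; `z ^ 3 = z` leaves
  -- only `0`, `1`, `-1`.
  have hmap : (∏ y ∈ S, (X - C y)).map (frobenius F 3) = ∏ y ∈ S, (X - C y) := by
    conv_rhs => rw [← himage, Finset.prod_image fun x _ y _ h => frobenius_inj F 3 h]
    simp [Polynomial.map_prod]
  have hlift : (∏ y ∈ S, (X - C y)) ∈ Polynomial.lifts (algebraMap (ZMod 3) F) := by
    rw [lifts_iff_coeff_lifts]
    intro k
    have h : (∏ y ∈ S, (X - C y)).coeff k ^ 3 = (∏ y ∈ S, (X - C y)).coeff k := by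
      conv_rhs => rw [← hmap, coeff_map, frobenius_def]
    generalize (∏ y ∈ S, (X - C y)).coeff k = z at h
    have hz : z * (z - 1) * (z + 1) = 0 := by linear_combination h
    rcases mul_eq_zero.1 hz with hz | hz
    · rcases mul_eq_zero.1 hz with hz | hz
      · exact ⟨0, by simp [hz]⟩
      · exact ⟨1, by simp [sub_eq_zero.1 hz]⟩
    · exact ⟨-1, by simp [eq_neg_of_add_eq_zero_left hz]⟩
  exact hlift

end FiniteField
-- The trace code of a primitive element.
section TraceCode

variable {m : ℕ} {F : Type*} [Field F]

theorem finrank_eq [Finite F] [Algebra (ZMod 3) F] (hF : Nat.card F = 3 ^ m) : Module.finrank (ZMod 3) F = m := by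
  have h := Module.natCard_eq_pow_finrank (K := ZMod 3) (V := F)
  rw [hF, Nat.card_zmod] at h
  exact (Nat.pow_right_injective (le_refl 2 |>.trans (by norm_num)) h).symm

theorem cast_three_pow_sub_one [Algebra (ZMod 3) F] (hm : m ≠ 0) : ((3 ^ m - 1 : ℕ) : F) = -1 := by
  have : CharP F 3 := charP_of_injective_algebraMap (algebraMap (ZMod 3) F).injective 3
  have h3 : (3 : F) = 0 := by exact_mod_cast CharP.cast_eq_zero F 3
  rw [Nat.cast_sub (Nat.one_le_pow _ _ (by norm_num))]
  simp [h3, hm]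

theorem pow_three_pow_eq_self_iff {β : Fˣ} (hβ : orderOf β = 3 ^ m - 1) {l : ℕ} (hl : l < m) :
    (β ^ 3 ^ l)⁻¹ * β = 1 ↔ l = 0 := by
  rw [← three_pow_modEq_one_iff hl, ← hβ, inv_mul_eq_one, ← zpow_natCast]
  nth_rw 2 [← zpow_one β]
  rw [zpow_eq_zpow_iff_modEq]
  push_cast
  rfl

theorem pow_three_pow_mul_self_ne_one {β : Fˣ} (hβ : orderOf β = 3 ^ m - 1) (hm : 2 ≤ m) {l : ℕ}
    (hl : l < m) : β ^ 3 ^ l * β ≠ 1 := by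
  intro h
  refine not_three_pow_modEq_neg_one hm hl ?_
  rw [mul_eq_one_iff_eq_inv, ← zpow_natCast, ← zpow_neg_one, zpow_eq_zpow_iff_modEq, hβ] at h
  exact_mod_cast h

/-- `β` differs from its other conjugates and from all conjugates of `β⁻¹`, so only the `b` term
with `l = 0` survives; the sign is `n = -1` in `F`. -/
theorem evalWord_traceWord_self [Finite F] [Algebra (ZMod 3) F] (hF : Nat.card F = 3 ^ m) {β : Fˣ} (hβ : orderOf β = 3 ^ m - 1)
    (hm : 2 ≤ m) (a b : F) :
    evalWord (β : F) (traceWord (ZMod 3) (3 ^ m - 1) β (a, b)) = -b := by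
  classical
  have hβn : β ^ (3 ^ m - 1) = 1 := hβ ▸ pow_orderOf_eq_one β
  rw [evalWord_traceWord hβn a b hβn, finrank_eq hF, Finset.sum_eq_single 0]
  · rw [if_neg (pow_three_pow_mul_self_ne_one hβ hm (by omega)),
      if_pos ((pow_three_pow_eq_self_iff hβ (by omega)).2 rfl), cast_three_pow_sub_one (by omega)]
    simp
  · intro l hl hl0
    have hl' := Finset.mem_range.1 hl
    rw [if_neg (pow_three_pow_mul_self_ne_one hβ hm hl'),
      if_neg (mt (pow_three_pow_eq_self_iff hβ hl').1 hl0), add_zero]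
  · intro h
    exact absurd (Finset.mem_range.2 (by omega)) h

theorem traceWord_inv [Algebra (ZMod 3) F] (n : ℕ) (β : Fˣ) (a b : F) :
    traceWord (ZMod 3) n β⁻¹ (a, b) = traceWord (ZMod 3) n β (b, a) := by
  funext k
  rw [traceWord_apply, traceWord_apply, inv_pow, inv_inv, add_comm]

theorem evalWord_inv_traceWord [Finite F] [Algebra (ZMod 3) F] (hF : Nat.card F = 3 ^ m) {β : Fˣ} (hβ : orderOf β = 3 ^ m - 1)
    (hm : 2 ≤ m) (a b : F) :
    evalWord ((β⁻¹ : Fˣ) : F) (traceWord (ZMod 3) (3 ^ m - 1) β (a, b)) = -a := by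
  rw [← traceWord_inv]
  exact evalWord_traceWord_self hF (by rwa [orderOf_inv]) hm b a

theorem traceWord_injective [Finite F] [Algebra (ZMod 3) F] (hF : Nat.card F = 3 ^ m) {β : Fˣ} (hβ : orderOf β = 3 ^ m - 1)
    (hm : 2 ≤ m) :
    Function.Injective (traceWord (ZMod 3) (3 ^ m - 1) β) := by
  rintro ⟨a, b⟩ ⟨a', b'⟩ h
  have h1 := evalWord_traceWord_self hF hβ hm a b
  have h2 := evalWord_inv_traceWord hF hβ hm a b
  rw [h, evalWord_traceWord_self hF hβ hm, neg_inj] at h1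
  rw [h, evalWord_inv_traceWord hF hβ hm, neg_inj] at h2
  rw [h1, h2]

/-- The values of `c` at `β⁻¹` and `β` dictate `a` and `b`. Subtracting that trace word leaves a
word vanishing on all conjugates of `β` and `β⁻¹` by Frobenius, and elsewhere by hypothesis. -/
theorem mem_range_traceWord_iff [Finite F] [Algebra (ZMod 3) F] (hF : Nat.card F = 3 ^ m) {β : Fˣ} (hβ : orderOf β = 3 ^ m - 1)
    (hm : 2 ≤ m) (c : Fin (3 ^ m - 1) → ZMod 3) :
    c ∈ LinearMap.range (traceWord (ZMod 3) (3 ^ m - 1) β) ↔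
      ∀ y : Fˣ, (∀ l : ℕ, y ≠ β ^ 3 ^ l ∧ y ≠ (β ^ 3 ^ l)⁻¹) → evalWord (y : F) c = 0 := by
  classical
  have hβn : β ^ (3 ^ m - 1) = 1 := hβ ▸ pow_orderOf_eq_one β
  have hy : ∀ y : Fˣ, y ^ (3 ^ m - 1) = 1 := by
    intro y
    rw [← hF, ← Nat.card_units, pow_card_eq_one']
  have zero : ∀ a b : F, ∀ y : Fˣ, (∀ l : ℕ, y ≠ β ^ 3 ^ l ∧ y ≠ (β ^ 3 ^ l)⁻¹) →
      evalWord (y : F) (traceWord (ZMod 3) (3 ^ m - 1) β (a, b)) = 0 := by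
    intro a b y h
    rw [evalWord_traceWord hβn a b (hy y)]
    refine Finset.sum_eq_zero fun l _ => ?_
    rw [if_neg fun h' => (h l).2 (eq_inv_of_mul_eq_one_right h'),
      if_neg fun h' => (h l).1 (inv_mul_eq_one.1 h').symm, add_zero]
  constructor
  · rintro ⟨⟨a, b⟩, rfl⟩
    exact zero a b
  · intro h
    set a : F := -evalWord ((β⁻¹ : Fˣ) : F) c with ha
    set b : F := -evalWord (β : F) c with hb
    refine ⟨(a, b), ?_⟩
    refine sub_eq_zero.1 (eq_zero_of_evalWord_eq_zero hβ fun y => ?_)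
    by_cases hyS : ∀ l : ℕ, y ≠ β ^ 3 ^ l ∧ y ≠ (β ^ 3 ^ l)⁻¹
    · rw [map_sub, h y hyS, zero a b y hyS, sub_zero]
    · push Not at hyS
      obtain ⟨l, hl⟩ := hyS
      by_cases hyl : y = β ^ 3 ^ l
      · rw [hyl, Units.val_pow_eq_pow_val, evalWord_pow_three_pow, map_sub,
          evalWord_traceWord_self hF hβ hm, hb]
        simp
      · rw [hl hyl, ← inv_pow, Units.val_pow_eq_pow_val, evalWord_pow_three_pow, map_sub,
          evalWord_inv_traceWord hF hβ hm, ha]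
        simp

/-- Orthogonality of `c` to the words of `Tr (a * x)` for all `a` says that `c(β)` is
trace-orthogonal to `F`, hence zero; likewise at `β⁻¹`. For a trace word these values are `-b` and
`-a`. -/
theorem isLCD_range_traceWord [Finite F] [Algebra (ZMod 3) F] (hF : Nat.card F = 3 ^ m) {β : Fˣ} (hβ : orderOf β = 3 ^ m - 1)
    (hm : 2 ≤ m) :
    IsLCD (LinearMap.range (traceWord (ZMod 3) (3 ^ m - 1) β)) := by
  have aux : ∀ (z : F) (c : Fin (3 ^ m - 1) → ZMod 3),
      (∀ a : F, ∑ i : Fin (3 ^ m - 1), c i * Algebra.trace (ZMod 3) F (a * z ^ (i : ℕ)) = 0) →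
      evalWord z c = 0 := by
    intro z c h
    refine (traceForm_nondegenerate (ZMod 3) F).1 _ fun a => ?_
    rw [Algebra.traceForm_apply, ← h a, evalWord_apply, Finset.sum_mul, map_sum]
    refine Finset.sum_congr rfl fun i _ => ?_
    rw [← smul_eq_mul (c i), ← map_smul, Algebra.smul_def]
    congr 1
    ring
  rw [IsLCD, eq_bot_iff]
  rintro _ ⟨⟨⟨a, b⟩, rfl⟩, hdual⟩
  have hdual' : ∀ a' b' : F, ∑ i, traceWord (ZMod 3) (3 ^ m - 1) β (a, b) i *
      traceWord (ZMod 3) (3 ^ m - 1) β (a', b') i = 0 := fun a' b' => hdual _ ⟨(a', b'), rfl⟩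
  have h1 := aux β (traceWord (ZMod 3) (3 ^ m - 1) β (a, b)) fun a' => by simpa [traceWord_apply] using hdual' a' 0
  have h2 := aux ((β⁻¹ : Fˣ) : F) (traceWord (ZMod 3) (3 ^ m - 1) β (a, b)) fun b' => by simpa [traceWord_apply] using hdual' 0 b'
  rw [evalWord_traceWord_self hF hβ hm, neg_eq_zero] at h1
  rw [evalWord_inv_traceWord hF hβ hm, neg_eq_zero] at h2
  rw [h1, h2]
  exact (Submodule.mem_bot _).2 (map_zero _)

end TraceCode

/-! ### Translation to exponents of `α` and assembly. -/

section Main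

variable {m : ℕ} {F : Type*} [Field F]

theorem pow_eq_delta2_pow_iff {α : Fˣ} {n : ℕ} (hα : orderOf α = n) (i j : ℕ) :
    (α ^ i = (α ^ delta2 m) ^ 3 ^ j ↔ (i : ℤ) ≡ delta2 m * 3 ^ j [ZMOD n]) ∧
      (α ^ i = ((α ^ delta2 m) ^ 3 ^ j)⁻¹ ↔ (i : ℤ) ≡ -delta2 m * 3 ^ j [ZMOD n]) := by
  rw [← hα]
  constructor
  · rw [← zpow_eq_zpow_iff_modEq, ← pow_mul, ← zpow_natCast, ← zpow_natCast]
    push_cast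
    rfl
  · rw [← zpow_eq_zpow_iff_modEq, ← pow_mul, ← zpow_natCast, ← zpow_natCast, ← zpow_neg, neg_mul]
    push_cast
    rfl

end Main
end TernaryLCD

open TernaryLCD

theorem theorem4p5 (m : ℕ) (hm : Odd m) (hm3 : 3 ≤ m)
    (F : Type*) [Field F] [Finite F] [Algebra (ZMod 3) F] (hF : Nat.card F = 3 ^ m)
    (α : Fˣ) (hα : ∀ y : Fˣ, y ∈ Subgroup.zpowers α) :
    -- the polynomial `∏_{i ∈ Z} (x - α^i)` has its coefficients in the prime field
    ∃ g : (ZMod 3)[X],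
      g.map (algebraMap (ZMod 3) F) =
        ∏ i ∈ TernaryLCD.definingSet m, (X - C ((α : F) ^ i)) ∧
      -- `i ↦ (α^δ₂)^i` lists each nonzero element of `F` exactly once
      Function.Bijective
        (fun i : Fin (3 ^ m - 1) => (α ^ TernaryLCD.delta2 m) ^ (i : ℕ)) ∧
      -- the code is the code of trace words, in this order of the nonzero elements
      (TernaryLCD.cyclicCode (3 ^ m - 1) g : Set (Fin (3 ^ m - 1) → ZMod 3)) =
        TernaryLCD.traceWords (ZMod 3)
          (fun i : Fin (3 ^ m - 1) => (α ^ TernaryLCD.delta2 m) ^ (i : ℕ)) ∧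
      TernaryLCD.IsCyclic (TernaryLCD.cyclicCode (3 ^ m - 1) g) ∧
      TernaryLCD.IsLCD (TernaryLCD.cyclicCode (3 ^ m - 1) g) ∧
      Module.finrank (ZMod 3) (TernaryLCD.cyclicCode (3 ^ m - 1) g) = 2 * m ∧
      TernaryLCD.MinDistGE (TernaryLCD.cyclicCode (3 ^ m - 1) g)
        (2 * TernaryLCD.delta2 m) ∧
      -- designed distance `2 δ₂`, with offset `-δ₂`
      TernaryLCD.definingSet m =
        TernaryLCD.bchDefiningSet 3 (3 ^ m - 1) (2 * TernaryLCD.delta2 m)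
            (-(TernaryLCD.delta2 m : ℤ)) ∪
          TernaryLCD.cyclotomicCoset 3 (3 ^ m - 1) (TernaryLCD.delta1 m) := by
  have hpos : 0 < 3 ^ m - 1 := Nat.sub_pos_of_lt (Nat.one_lt_pow (by omega) (by norm_num))
  have hαo : orderOf α = 3 ^ m - 1 := by
    rw [orderOf_eq_card_of_forall_mem_zpowers hα, Nat.card_units, hF]
  have hβo : orderOf (α ^ delta2 m) = 3 ^ m - 1 := by
    rw [Nat.Coprime.orderOf_pow (hαo ▸ coprime_delta2 hm hm3), hαo]
  have hα1 : α ^ (3 ^ m - 1) = 1 := hαo ▸ pow_orderOf_eq_one α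
  have hβ1 : (α ^ delta2 m) ^ (3 ^ m - 1) = 1 := by rw [pow_right_comm, hα1, one_pow]
  have hlt : ∀ i ∈ definingSet m, i < 3 ^ m - 1 := by
    intro i hi
    rw [definingSet, Finset.mem_union, Finset.mem_biUnion] at hi
    rcases hi with ⟨s, -, h⟩ | h <;> exact (mem_cyclotomicCoset.1 h).1
  have hinj : Set.InjOn (fun i : ℕ => (α : F) ^ i) (definingSet m) := by
    intro i hi j hj h
    exact pow_injOn_Iio_orderOf (x := α) (by simpa [hαo] using hlt i hi)
      (by simpa [hαo] using hlt j hj)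
      (Units.ext (by simpa using h))
  obtain ⟨g, hg⟩ : ∃ g : (ZMod 3)[X], g.map (algebraMap (ZMod 3) F) =
      ∏ i ∈ definingSet m, (X - C ((α : F) ^ i)) := by
    classical
    obtain ⟨g, hg⟩ := exists_map_eq_prod ((definingSet m).image fun i => (α : F) ^ i) (by
      intro y hy
      obtain ⟨i, hi, rfl⟩ := Finset.mem_image.1 hy
      obtain ⟨i', hi', h⟩ := exists_mem_definingSet_modEq hm3 hi
      refine Finset.mem_image.2 ⟨i', hi', ?_⟩
      have : α ^ i' = α ^ (i * 3) := pow_eq_pow_iff_modEq.2 (hαo ▸ h)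
      simpa [pow_mul] using congrArg Units.val this)
    exact ⟨g, by rw [hg, Finset.prod_image hinj]⟩
  have hmem := mem_cyclicCode_iff (n := 3 ^ m - 1) hg (by simpa using congrArg Units.val hα1) hinj
  have hcode : cyclicCode (3 ^ m - 1) g =
      LinearMap.range (traceWord (ZMod 3) (3 ^ m - 1) (α ^ delta2 m)) := by
    ext c
    rw [hmem, mem_range_traceWord_iff hF hβo (by omega)]
    have hiff : ∀ i < 3 ^ m - 1, (i ∈ definingSet m ↔ ∀ l : ℕ,
        α ^ i ≠ (α ^ delta2 m) ^ 3 ^ l ∧ α ^ i ≠ ((α ^ delta2 m) ^ 3 ^ l)⁻¹) := by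
      intro i hi
      rw [mem_definingSet_iff hm hm3 hi]
      exact forall_congr' fun l => and_congr (not_congr (pow_eq_delta2_pow_iff hαo i l).1.symm)
        (not_congr (pow_eq_delta2_pow_iff hαo i l).2.symm)
    constructor
    · intro h y hy
      obtain ⟨k, rfl⟩ := (isOfFinOrder_iff_pow_eq_one.2 ⟨_, hpos, hα1⟩).mem_powers_iff_mem_zpowers.2
        (hα y)
      obtain ⟨i, hi, hik⟩ : ∃ i < 3 ^ m - 1, α ^ i = α ^ k :=
        ⟨k % (3 ^ m - 1), Nat.mod_lt _ hpos, by rw [← hαo, pow_mod_orderOf]⟩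
      simp only [← hik] at hy ⊢
      simpa using h i ((hiff i hi).2 hy)
    · intro h i hi
      simpa using h (α ^ i) ((hiff i (hlt i hi)).1 hi)
  refine ⟨g, hg, ?_, ?_, ?_, ?_, ?_, ?_, ?_⟩
  · have hfinj : Function.Injective (fun i : Fin (3 ^ m - 1) => (α ^ delta2 m) ^ (i : ℕ)) := by
      intro i j h
      exact Fin.ext (pow_injOn_Iio_orderOf (by simp [hβo]) (by simp [hβo]) h)
    refine (Nat.bijective_iff_injective_and_card _).2 ⟨hfinj, ?_⟩
    rw [Nat.card_units, hF, Nat.card_fin]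
  · rw [hcode, range_traceWord]
  · rw [hcode]
    exact isCyclic_range_traceWord hβ1
  · rw [hcode]
    exact isLCD_range_traceWord hF hβo (by omega)
  · rw [hcode, LinearMap.finrank_range_of_inj (traceWord_injective hF hβo (by omega)),
      Module.finrank_prod, finrank_eq hF, two_mul]
  · intro u hu v hv huv
    by_contra hlt'
    -- The zeros with `|s| < δ₂` start at `1 - δ₂` and number `2 * δ₂ - 1`, so a difference of that
    -- weight or less vanishes.
    refine huv (sub_eq_zero.1 (eq_zero_of_consecutive_zeros (F := F) hαo (b := 1 - delta2 m)
      (d := 2 * delta2 m - 1) (c := u - v) ?_ ?_))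
    · intro i hi
      set s : ℤ := 1 - delta2 m + i with hs
      have hnpos : (0 : ℤ) < ((3 ^ m - 1 : ℕ) : ℤ) := by exact_mod_cast hpos
      obtain ⟨t, ht⟩ := Int.eq_ofNat_of_zero_le (Int.emod_nonneg s hnpos.ne')
      have hts : (t : ℤ) ≡ s [ZMOD ((3 ^ m - 1 : ℕ) : ℤ)] := ht ▸ Int.mod_modEq _ _
      have htlt : t < 3 ^ m - 1 := by
        have := Int.emod_lt_of_pos s hnpos
        omega
      have hpow : α ^ s = α ^ t := by
        rw [← zpow_natCast, zpow_eq_zpow_iff_modEq, hαo]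
        exact hts.symm
      have htZ : t ∈ definingSet m := by
        rw [definingSet, Finset.mem_union, Finset.mem_biUnion]
        exact Or.inl ⟨s, Finset.mem_Ioo.2 ⟨by omega, by omega⟩,
          mem_cyclotomicCoset.2 ⟨htlt, 0, by simpa using hts⟩⟩
      rw [hpow, Units.val_pow_eq_pow_val]
      exact (hmem _).1 (sub_mem hu hv) t htZ
    · have hcard : (Finset.univ.filter fun k => (u - v) k ≠ 0).card = hammingDist u v := by
        simp [hammingDist, sub_eq_zero]
      omega
  · rw [definingSet, bchDefiningSet]
    congr 3
    push_cast
    ring
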